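/- Let $G$ be a finite undirected multigraph, with $n$ vertices; multiple edges and loops are allowed. Fix an orientation of $G$, that is, name the two ends of every edge $e$ its head $h(e)$ and its tail $t(e)$ (with $h(e)=t(e)$ if $e$ is a loop), and regard every edge $e$ (also a loop) as a pair of oppositely oriented edges $e,-e$. Let $d\ge 1$. A map $\sigma$ from the oriented edges of $G$ to the symmetric group $S_d$ with $\sigma_{-e}=\sigma_e^{-1}$ determines a $d$-covering $H_\sigma$ of $G$: the multigraph with vertices $v_1,\dots,v_d$ for every vertex $v$ of $G$ and, for every positively oriented edge $e$ of $G$, the $d$ undirected edges joining $h(e)_i$ to $t(e)_{\sigma_e(i)}$, $1\le i\le d$. Let $\mathcal C_{d,G}$ be the finite set of all such $\sigma$, with the uniform distribution. A matching of a multigraph $H$ is a set of non-loop edges of $H$ no two of which share a vertex; if $H$ has $N$ vertices and $m_i$ matchings of size $i$, its matching polynomial is $\mu_H(x)=\sum_{i=0}^{\lfloor N/2\rfloor}(-1)^i m_i x^{N-2i}$. The $d$-matching polynomial of $G$ is $$\mu_{d,G}(x)=\frac1{|\mathcal C_{d,G}|}\sum_{\sigma\in\mathcal C_{d,G}}\mu_{H_\sigma}(x).$$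 Then $\mu_{d,G}(x)$ is real-rooted, i.e. all its complex zeros are real, for every $d\ge 1$. -/

import Mathlib

namespace Graph

universe u v

variable {α : Type u} {β : Type v}

/-- An orientation of a multigraph: for every edge `e`, its two ends (equal if `e` is a loop)
are named the head and the tail of the positively oriented copy of `e`. -/
structure EdgeOrientation (G : Graph α β) where
  head : G.edgeSet → α
  tail : G.edgeSet → α
  isLink : ∀ e : G.edgeSet, G.IsLink e (head e) (tail e)

/-- Every multigraph has an orientation. -/
theorem EdgeOrientation.nonempty (G : Graph α β) : Nonempty G.EdgeOrientation := by
  have h : ∀ e : G.edgeSet, ∃ p : α × α, G.IsLink e p.1 p.2 := fun e => by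
    obtain ⟨x, y, hxy⟩ := Graph.exists_isLink_of_mem_edgeSet e.2
    exact ⟨(x, y), hxy⟩
  choose p hp using h
  exact ⟨⟨fun e => (p e).1, fun e => (p e).2, hp⟩⟩

/-- The oriented edges of a multigraph: two for every edge (also for a loop). Relative to an
orientation, `(e, true)` is the positively and `(e, false)` the negatively oriented copy of `e`. -/
abbrev OrientedEdge (G : Graph α β) : Type v := G.edgeSet × Bool

/-- The same edge with the opposite orientation. -/
def OrientedEdge.rev {G : Graph α β} (e : G.OrientedEdge) : G.OrientedEdge := (e.1, !e.2)

/-- An `S_d`-labeling: a map `σ` from the oriented edges to `S_d` with `σ(-e) = σ(e)⁻¹`. -/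
def PermLabeling (G : Graph α β) (d : ℕ) : Type v :=
  {σ : G.OrientedEdge → Equiv.Perm (Fin d) // ∀ e : G.OrientedEdge, σ e.rev = (σ e)⁻¹}

/-- The permutation by which a labeling `σ` labels the positively oriented copy of `e`. -/
def PermLabeling.pos {G : Graph α β} {d : ℕ} (σ : G.PermLabeling d) (e : G.edgeSet) :
    Equiv.Perm (Fin d) := σ.1 (e, true)

/-- The `d`-covering of `G` determined by a labeling `σ`: its vertices are the pairs `(v, i)`,
and every edge `e` of `G` is replaced by the `d` edges `(e, i)`, where `(e, i)` joins
`(head e, i)` to `(tail e, σ e i)`. -/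
def covering (G : Graph α β) (o : G.EdgeOrientation) {d : ℕ} (σ : G.PermLabeling d) :
    Graph (α × Fin d) (β × Fin d) where
  vertexSet := {x | x.1 ∈ G.vertexSet}
  IsLink e x y := ∃ he : e.1 ∈ G.edgeSet,
    s(x, y) = s((o.head ⟨e.1, he⟩, e.2), (o.tail ⟨e.1, he⟩, σ.pos ⟨e.1, he⟩ e.2))
  isLink_symm := by
    rintro e -
    exact ⟨fun x y ⟨he, h⟩ => ⟨he, Sym2.eq_swap.trans h⟩⟩
  eq_or_eq_of_isLink_of_isLink := by
    rintro e x y v w ⟨he, h⟩ ⟨_, h'⟩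
    have hx : x ∈ s(v, w) := by
      rw [h', ← h]
      exact Sym2.mem_mk_left x y
    exact Sym2.mem_iff.1 hx
  left_mem_of_isLink := by
    rintro e x y ⟨he, h⟩
    have hx : x ∈ s((o.head ⟨e.1, he⟩, e.2), (o.tail ⟨e.1, he⟩, σ.pos ⟨e.1, he⟩ e.2)) := by
      rw [← h]
      exact Sym2.mem_mk_left x y
    rcases Sym2.mem_iff.1 hx with rfl | rfl
    · exact (o.isLink ⟨e.1, he⟩).left_mem
    · exact (o.isLink ⟨e.1, he⟩).right_mem

/-- A matching of a multigraph: a finite set of edges, none of which is a loop, such that no two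
distinct edges share a vertex. -/
def IsMatching (G : Graph α β) (M : Finset β) : Prop :=
  (∀ e ∈ M, e ∈ G.edgeSet ∧ ∀ x, ¬ G.IsLoopAt e x) ∧
    ∀ e ∈ M, ∀ f ∈ M, e ≠ f → ∀ x, ¬ (G.Inc e x ∧ G.Inc f x)

/-- The number `m_i` of matchings of size `i`. -/
noncomputable def numMatchings (G : Graph α β) (i : ℕ) : ℕ :=
  {M : Finset β | G.IsMatching M ∧ M.card = i}.ncard

/-- The matching polynomial `∑_{i ≤ n/2} (-1)^i m_i x^(n - 2i)` of a multigraph with `n` vertices. -/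
noncomputable def matchingPoly (G : Graph α β) : Polynomial ℤ :=
  ∑ i ∈ Finset.range (G.vertexSet.ncard / 2 + 1),
    Polynomial.C ((-1 : ℤ) ^ i * (G.numMatchings i : ℤ)) *
      Polynomial.X ^ (G.vertexSet.ncard - 2 * i)

/-- The `d`-matching polynomial: the average of the matching polynomials of all `d`-coverings,
taken over the uniform distribution on the (finite) set of labelings. -/
noncomputable def dMatchingPoly (G : Graph α β) (o : G.EdgeOrientation) (d : ℕ) :
    Polynomial ℝ :=
  (Nat.card (G.PermLabeling d) : ℝ)⁻¹ •
    ∑ᶠ σ : G.PermLabeling d, ((G.covering o σ).matchingPoly).map (Int.castRingHom ℝ)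

end Graph

/-- A real polynomial is real-rooted if all its complex zeros are real. -/
def Polynomial.IsRealRooted (p : Polynomial ℝ) : Prop :=
  ∀ z : ℂ, Polynomial.aeval z p = 0 → z.im = 0

/-! Attach a variable to every vertex of a covering and take the product of `1 - X a * X b` over its
edges `ab`. Loops and edges sharing a vertex produce squares, so the multi-affine part of this
product is the signed generating function of matchings. At the constant vector `y = ±1/z` it equals
the matching polynomial at `z` up to a power of `z`. For non-real `z` the sign can be chosen with
`y` in the upper half-plane, so it suffices that the multi-affine part, summed over all labelings,
is stable: no zeros when all variables lie in the upper half-plane.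

Labels of different edges are independent, so the sum is a product of one `edgeSum` per edge of `G`,
and the edges can be multiplied in one by one. Two operations preserve stability: multiplication by
`1 - X a * X b` with `a ≠ b`, modulo squares, and symmetrization over a fiber. Both reduce to an
explicit criterion for bilinear polynomials in two variables. If `u ≠ v`, the edge sum is a
symmetrization of `∏ i, (1 - X (u, i) * X (v, i))`, and the product of the other edge sums, being
invariant under fiber permutations, can be moved inside it.

For a loop this fails, because permutations of different cycle types give lifts that are not
relabelings of one another. Modulo squares, however, the sum over all permutations equals the sum
over all relabelings of one Hamiltonian path on the fiber (`SquareZero.sum_perm_prod_eq_sum_path`),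
which is again a symmetrization. -/

/-! ### Bilinear polynomials on two upper half-planes -/

theorem Complex.exists_sq_eq_im_nonneg (γ : ℂ) : ∃ ζ : ℂ, ζ ^ 2 = γ ∧ 0 ≤ ζ.im := by
  obtain ⟨ζ, hζ⟩ := IsAlgClosed.exists_pow_nat_eq γ two_pos
  rcases le_total 0 ζ.im with h | h
  · exact ⟨ζ, hζ, h⟩
  · exact ⟨-ζ, by rw [neg_sq, hζ], by simpa using h⟩

/-- Non-vanishing of `(z + α) (w + β) + γ` on the product of two upper half-planes. -/
theorem Complex.add_mul_add_add_ne_zero_iff (α β γ : ℂ) :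
    (∀ z w : ℂ, 0 < z.im → 0 < w.im → (z + α) * (w + β) + γ ≠ 0) ↔
      0 ≤ α.im ∧ 0 ≤ β.im ∧ ‖γ‖ + γ.re ≤ 2 * (α.im * β.im) := by
  have key : ∀ α β γ : ℂ, (∀ z w : ℂ, 0 < z.im → 0 < w.im → (z + α) * (w + β) + γ ≠ 0) →
      0 ≤ α.im := by
    intro α β γ h
    by_contra! hα
    -- The values `z + α = iγ/R` and `w + β = iR` have product `-γ`; for large `R` both `z` and `w`
    -- lie in the upper half-plane.
    set R : ℝ := max (1 + β.im) (max 1 ((|γ.re| + 1) / (-α.im)))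
    have h1 : 1 + β.im ≤ R := le_max_left _ _
    have h2 : 1 ≤ R := (le_max_left _ _).trans (le_max_right _ _)
    have h3 : (|γ.re| + 1) / (-α.im) ≤ R := (le_max_right _ _).trans (le_max_right _ _)
    have hR : 0 < R := by linarith
    have hRC : (R : ℂ) ≠ 0 := by exact_mod_cast hR.ne'
    refine h (-α + (γ / R) * Complex.I) (-β + R * Complex.I) ?_ ?_ ?_
    · rw [div_le_iff₀ (by linarith)] at h3
      have h4 : -γ.re / R < -α.im := by
        rw [div_lt_iff₀ hR]
        nlinarith [neg_abs_le γ.re]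
      simp only [Complex.add_im, Complex.neg_im, Complex.mul_im, Complex.I_im, Complex.I_re,
        Complex.div_ofReal_re, mul_zero, mul_one, add_zero]
      rw [neg_div] at h4
      linarith
    · simp
      linarith
    · have : (γ / R) * R = γ := div_mul_cancel₀ _ hRC
      linear_combination Complex.I ^ 2 * this + γ * Complex.I_sq
  constructor
  · intro h
    have hα := key α β γ h
    have hβ := key β α γ fun z w hz hw => by rw [mul_comm]; exact h w z hw hz
    refine ⟨hα, hβ, ?_⟩
    by_contra! hlt
    -- With `ζ² = -γ`, the quantity `‖γ‖ + γ.re` is `2 ζ.im²`. A zero is sought with `z + α = rζ`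
    -- and `w + β = ζ/r`; `p = r ζ.im` must exceed `α.im` while `ζ.im²/p` exceeds `β.im`.
    obtain ⟨ζ, hζ, hζ0⟩ := Complex.exists_sq_eq_im_nonneg (-γ)
    have hn : ‖γ‖ = ζ.re ^ 2 + ζ.im ^ 2 := by
      rw [← norm_neg γ, ← hζ, norm_pow, ← Complex.normSq_eq_norm_sq, Complex.normSq_apply]
      ring
    have hr : -γ.re = ζ.re ^ 2 - ζ.im ^ 2 := by
      rw [← Complex.neg_re, ← hζ]
      simp [sq]
    have hK : α.im * β.im < ζ.im ^ 2 := by nlinarith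
    have hζ1 : 0 < ζ.im := by
      rcases hζ0.eq_or_lt with h0 | h0
      · rw [← h0] at hK
        nlinarith [mul_nonneg hα hβ]
      · exact h0
    obtain ⟨p, hp1, hp2⟩ : ∃ p : ℝ, α.im < p ∧ p * β.im < ζ.im ^ 2 := by
      rcases hβ.eq_or_lt with h0 | h0
      · refine ⟨α.im + 1, by linarith, ?_⟩
        rw [← h0]
        nlinarith
      · obtain ⟨p, hp1, hp2⟩ := exists_between ((lt_div_iff₀ h0).2 hK)
        exact ⟨p, hp1, (lt_div_iff₀ h0).1 hp2⟩
    have hp : 0 < p := by linarith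
    set r : ℝ := p / ζ.im
    have hr0 : 0 < r := by positivity
    have hrC : (r : ℂ) ≠ 0 := by exact_mod_cast hr0.ne'
    refine h (r * ζ - α) (ζ / r - β) ?_ ?_ ?_
    · have : r * ζ.im = p := div_mul_cancel₀ _ hζ1.ne'
      simp
      linarith
    · have : ζ.im / r = ζ.im ^ 2 / p := by
        simp only [r]; field_simp
      simp only [Complex.sub_im, Complex.div_ofReal_im, this, sub_pos]
      rw [lt_div_iff₀ hp]
      linarith
    · have : (r * ζ - α + α) * (ζ / r - β + β) = ζ ^ 2 := by
        field_simp
        ring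
      rw [this, hζ]
      ring
  · rintro ⟨hα, hβ, hγ⟩ z w hz hw h0
    set Z := z + α with hZ
    set W := w + β with hW
    have hZi : α.im < Z.im := by simp [hZ, hz]
    have hWi : β.im < W.im := by simp [hW, hw]
    have h1 : γ = -(Z * W) := by linear_combination h0
    -- From `Re (Z * conj W) ≤ ‖Z * W‖` one gets `‖γ‖ + γ.re ≥ 2 Z.im W.im`, which is too large.
    have h2 : (Z.re * W.re + Z.im * W.im) ≤ ‖Z * W‖ := by
      have := Complex.re_le_norm (Z * (starRingEnd ℂ) W)
      simpa using this
    rw [h1, norm_neg] at hγ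
    simp only [Complex.neg_re, Complex.mul_re] at hγ
    nlinarith [mul_lt_mul'' hZi hWi hα hβ]

/-- A bilinear polynomial without zeros on the product of two upper half-planes has none after
a random exchange of its variables. -/
theorem Complex.swap_average_ne_zero {a b c d : ℂ}
    (h : ∀ z w : ℂ, 0 < z.im → 0 < w.im → a + b * z + c * w + d * (z * w) ≠ 0)
    {s t : ℝ} (hs : 0 ≤ s) (ht : 0 ≤ t) (hst : 0 < s + t) (z w : ℂ) (hz : 0 < z.im)
    (hw : 0 < w.im) :
    s * (a + b * z + c * w + d * (z * w)) + t * (a + b * w + c * z + d * (w * z)) ≠ 0 := by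
  wlog hst1 : s + t = 1 generalizing s t
  · have hC : ((s + t : ℝ) : ℂ) ≠ 0 := by exact_mod_cast hst.ne'
    have := this (s := s / (s + t)) (t := t / (s + t)) (by positivity) (by positivity)
      (by rw [← add_div, div_self hst.ne']; exact one_pos) (by rw [← add_div, div_self hst.ne'])
    contrapose! this
    push_cast at this hC ⊢
    rw [div_mul_eq_mul_div, div_mul_eq_mul_div, ← add_div, this, zero_div]
  obtain rfl : t = 1 - s := by linarith
  have hconv : ∀ u v : ℂ, 0 < u.im → 0 < v.im → 0 < (s * u + (1 - s : ℝ) * v).im := by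
    intro u v hu hv
    simp only [Complex.add_im, Complex.im_ofReal_mul]
    rcases hs.eq_or_lt with h0 | h0
    · rw [← h0]; simpa
    · have := mul_pos h0 hu
      have := mul_nonneg ht hv.le
      linarith
  by_cases hd : d = 0
  · have := h _ _ (hconv z w hz hw) (hconv w z hw hz)
    subst hd
    convert this using 1
    push_cast
    ring
  · have hc := (Complex.add_mul_add_add_ne_zero_iff (c / d) (b / d) (a / d - c / d * (b / d))).1 (by
      intro u v hu hv h0
      refine h u v hu hv (mul_left_cancel₀ hd ?_)
      field_simp at h0
      linear_combination h0)
    obtain ⟨hα, hβ, hγ⟩ := hc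
    set α := c / d with hαd
    set β := b / d with hβd
    set γ := a / d - α * β with hγd
    have := (Complex.add_mul_add_add_ne_zero_iff (s * α + (1 - s : ℝ) * β)
      (s * β + (1 - s : ℝ) * α) (γ - (s * (1 - s) : ℝ) * (α - β) ^ 2)).2 ⟨?_, ?_, ?_⟩ z w hz hw
    · contrapose! this
      have hbd : b = β * d := (div_mul_cancel₀ b hd).symm
      have hcd : c = α * d := (div_mul_cancel₀ c hd).symm
      have had : a = (γ + α * β) * d := by
        rw [hγd]; field_simp; ring
      rw [hbd, hcd, had] at this
      refine (mul_eq_zero.1 (?_ : d * _ = 0)).resolve_left hd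
      rw [← this]
      push_cast
      ring
    · simp only [Complex.add_im, Complex.im_ofReal_mul]
      positivity
    · simp only [Complex.add_im, Complex.im_ofReal_mul]
      positivity
    -- Both sides of the criterion gain `2s(1-s)(α.im - β.im)²`: the right side exactly, the left
    -- side at most.
    · have h1 : ‖γ - (s * (1 - s) : ℝ) * (α - β) ^ 2‖ ≤
          ‖γ‖ + s * (1 - s) * ((α.re - β.re) ^ 2 + (α.im - β.im) ^ 2) := by
        refine (norm_sub_le _ _).trans_eq ?_
        rw [norm_mul, norm_pow, ← Complex.normSq_eq_norm_sq, Complex.normSq_apply,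
          Complex.norm_real, Real.norm_of_nonneg (mul_nonneg hs ht)]
        simp [sq]
      have h2 : (γ - (s * (1 - s) : ℝ) * (α - β) ^ 2).re =
          γ.re - s * (1 - s) * ((α.re - β.re) ^ 2 - (α.im - β.im) ^ 2) := by
        rw [Complex.sub_re, Complex.re_ofReal_mul]
        simp [sq]
      rw [h2]
      simp only [Complex.add_im, Complex.im_ofReal_mul]
      linarith

/-- Multiplication by `1 - z w`, modulo `z ^ 2` and `w ^ 2`, keeps a bilinear polynomial free of
zeros on the product of two upper half-planes. -/
theorem Complex.bilinear_sub_ne_zero {a b c d : ℂ}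
    (h : ∀ z w : ℂ, 0 < z.im → 0 < w.im → a + b * z + c * w + d * (z * w) ≠ 0)
    (z w : ℂ) (hz : 0 < z.im) (hw : 0 < w.im) :
    a + b * z + c * w + (d - a) * (z * w) ≠ 0 := by
  by_cases ha : a = 0
  · subst ha
    simpa using h z w hz hw
  have hinv : ∀ u : ℂ, 0 < u.im → u ≠ 0 ∧ 0 < (-u⁻¹).im := by
    intro u hu
    have hu0 : u ≠ 0 := by rintro rfl; simp at hu
    refine ⟨hu0, ?_⟩
    rw [Complex.neg_im, Complex.inv_im, neg_div, neg_neg]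
    exact div_pos hu (Complex.normSq_pos.2 hu0)
  -- The inversion `z ↦ -1/z` preserves the upper half-plane and makes `a` the leading coefficient.
  -- Lowering `d` by `a` then lowers `γ` by 1, which cannot increase `‖γ‖ + γ.re`.
  obtain ⟨hα, hβ, hγ⟩ := (Complex.add_mul_add_add_ne_zero_iff (-(b / a)) (-(c / a))
      (d / a - b / a * (c / a))).1 (by
    intro u v hu hv h0
    obtain ⟨hu0, hu'⟩ := hinv u hu
    obtain ⟨hv0, hv'⟩ := hinv v hv
    refine h _ _ hu' hv' ?_
    field_simp at h0 ⊢
    refine mul_left_cancel₀ ha ?_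
    linear_combination h0)
  obtain ⟨hz0, hz'⟩ := hinv z hz
  obtain ⟨hw0, hw'⟩ := hinv w hw
  have := (Complex.add_mul_add_add_ne_zero_iff (-(b / a)) (-(c / a))
      (d / a - b / a * (c / a) - 1)).2 ⟨hα, hβ, ?_⟩ _ _ hz' hw'
  · contrapose! this
    field_simp
    linear_combination a * this
  · have := norm_sub_le (d / a - b / a * (c / a)) 1
    rw [norm_one] at this
    rw [Complex.sub_re (d / a - b / a * (c / a)) 1, Complex.one_re]
    linarith

/-! ### Stable multi-affine functions -/

/-- A function of several complex variables that is affine in every one of them. -/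
def MultiAffine {ι : Type*} [DecidableEq ι] (f : (ι → ℂ) → ℂ) : Prop :=
  ∀ (z : ι → ℂ) (i : ι) (w : ℂ), f (Function.update z i w) =
    f (Function.update z i 0) + w * (f (Function.update z i 1) - f (Function.update z i 0))

/-- A function without zeros on the product of upper half-planes. -/
def UpperStable {ι : Type*} (f : (ι → ℂ) → ℂ) : Prop :=
  ∀ z : ι → ℂ, (∀ i, 0 < (z i).im) → f z ≠ 0

namespace MultiAffine

variable {ι κ : Type*} [DecidableEq ι] [DecidableEq κ]

theorem sum {τ : Type*} (s : Finset τ) {f : τ → (ι → ℂ) → ℂ} (hf : ∀ a ∈ s, MultiAffine (f a)) :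
    MultiAffine fun z => ∑ a ∈ s, f a z := by
  intro z i w
  rw [← Finset.sum_sub_distrib, Finset.mul_sum, ← Finset.sum_add_distrib]
  exact Finset.sum_congr rfl fun a ha => hf a ha z i w

theorem comp_perm {f : (ι → ℂ) → ℂ} (hf : MultiAffine f) (σ : Equiv.Perm ι) :
    MultiAffine fun z => f (z ∘ σ) := by
  intro z i w
  have h : ∀ w, Function.update z i w ∘ σ = Function.update (z ∘ σ) (σ.symm i) w := fun w =>
    (Function.update_comp_equiv z σ i w)
  simp only [h]
  exact hf _ _ _

theorem const_mul {f : (ι → ℂ) → ℂ} (hf : MultiAffine f) (c : ℂ) :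
    MultiAffine fun z => c * f z := by
  intro z i w
  simp only
  rw [hf z i w]
  ring

theorem add {f g : (ι → ℂ) → ℂ} (hf : MultiAffine f) (hg : MultiAffine g) :
    MultiAffine fun z => f z + g z := by
  intro z i w
  simp only
  rw [hf z i w, hg z i w]
  ring

/-- A multi-affine function is bilinear in any two of its variables. -/
theorem exists_bilinear {f : (ι → ℂ) → ℂ} (hf : MultiAffine f) {u v : ι} (huv : u ≠ v)
    (z : ι → ℂ) : ∃ b c d : ℂ, ∀ p q : ℂ,
      f (Function.update (Function.update z u p) v q) =
        f (Function.update (Function.update z u 0) v 0) + b * p + c * q + d * (p * q) := by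
  refine ⟨f (Function.update (Function.update z u 1) v 0) -
      f (Function.update (Function.update z u 0) v 0),
    f (Function.update (Function.update z u 0) v 1) -
      f (Function.update (Function.update z u 0) v 0),
    f (Function.update (Function.update z u 1) v 1) -
      f (Function.update (Function.update z u 1) v 0) -
      f (Function.update (Function.update z u 0) v 1) +
      f (Function.update (Function.update z u 0) v 0), fun p q => ?_⟩
  have h : ∀ r, f (Function.update (Function.update z u p) v r) =
      f (Function.update (Function.update z u 0) v r) +
        p * (f (Function.update (Function.update z u 1) v r) -
          f (Function.update (Function.update z u 0) v r)) := by
    intro r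
    simp only [Function.update_comm huv]
    exact hf _ _ _
  rw [hf _ v q, h 0, h 1]
  ring

/-- The random exchange of two variables preserves stability. -/
theorem upperStable_swap {f : (ι → ℂ) → ℂ} (hf : MultiAffine f) (hs : UpperStable f)
    {u v : ι} (huv : u ≠ v) {s t : ℝ} (hs0 : 0 ≤ s) (ht0 : 0 ≤ t) (hst : 0 < s + t) :
    UpperStable fun z => s * f z + t * f (z ∘ Equiv.swap u v) := by
  intro z hz
  obtain ⟨b, c, d, h⟩ := hf.exists_bilinear huv z
  have h1 : Function.update (Function.update z u (z u)) v (z v) = z := by simp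
  have h2 : Function.update (Function.update z u (z v)) v (z u) = z ∘ Equiv.swap u v := by
    ext i
    by_cases hi : i = v
    · subst hi; simp
    · by_cases hi' : i = u
      · subst hi'; simp [hi]
      · simp [hi, hi', Equiv.swap_apply_of_ne_of_ne hi' hi]
  have h3 := h (z u) (z v)
  have h4 := h (z v) (z u)
  rw [h1] at h3
  rw [h2] at h4
  simp only
  rw [h3, h4]
  refine Complex.swap_average_ne_zero (fun p q hp hq => ?_) hs0 ht0 hst _ _ (hz u) (hz v)
  rw [← h]
  refine hs _ fun i => ?_
  by_cases hi : i = v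
  · subst hi; simpa
  · by_cases hi' : i = u
    · subst hi'; simpa [hi]
    · simpa [hi, hi'] using hz i

/-- Multiplication by `1 - z_u z_v` modulo squares preserves stability. -/
theorem upperStable_sub {f : (ι → ℂ) → ℂ} (hf : MultiAffine f) (hs : UpperStable f)
    {u v : ι} (huv : u ≠ v) : UpperStable fun z =>
      f z - z u * z v * f (Function.update (Function.update z u 0) v 0) := by
  intro z hz
  obtain ⟨b, c, d, h⟩ := hf.exists_bilinear huv z
  have h1 : Function.update (Function.update z u (z u)) v (z v) = z := by simp
  have h3 := h (z u) (z v)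
  rw [h1] at h3
  have := Complex.bilinear_sub_ne_zero (fun p q hp hq => ?_) _ _ (hz u) (hz v)
    (a := f (Function.update (Function.update z u 0) v 0)) (b := b) (c := c) (d := d)
  · simp only
    rw [h3]
    contrapose! this
    linear_combination this
  rw [← h]
  refine hs _ fun i => ?_
  by_cases hi : i = v
  · subst hi; simpa
  · by_cases hi' : i = u
    · subst hi'; simpa [hi]
    · simpa [hi, hi'] using hz i

end MultiAffine

/-! ### Symmetrization by random transpositions -/

theorem Equiv.Perm.card_mul_sum_apply {α : Type*} [Fintype α] [DecidableEq α] (φ : α → ℂ)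
    (i : α) : (Fintype.card α : ℂ) * ∑ σ : Equiv.Perm α, φ (σ i) =
      (Fintype.card α).factorial * ∑ k, φ k := by
  have h1 : ∀ j, ∑ σ : Equiv.Perm α, φ (σ j) = ∑ σ : Equiv.Perm α, φ (σ i) := fun j =>
    Fintype.sum_equiv (Equiv.mulRight (Equiv.swap i j)) _ _ fun σ => by simp
  calc (Fintype.card α : ℂ) * ∑ σ : Equiv.Perm α, φ (σ i)
      = ∑ j : α, ∑ σ : Equiv.Perm α, φ (σ j) := by simp [h1]
    _ = ∑ σ : Equiv.Perm α, ∑ j : α, φ (σ j) := Finset.sum_comm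
    _ = ∑ _σ : Equiv.Perm α, ∑ j : α, φ j :=
        Finset.sum_congr rfl fun σ _ => Equiv.sum_comp σ φ
    _ = _ := by simp [Fintype.card_perm]

/-- Uniform permutations of `Option α` as a product of a uniform permutation of `α`, a random
transposition and a uniform permutation of `α`. -/
theorem Equiv.Perm.sum_option_eq {α : Type*} [Fintype α] [DecidableEq α]
    (φ : Equiv.Perm (Option α) → ℂ) (i : α) :
    ∑ σ : Equiv.Perm α, ∑ τ : Equiv.Perm α, (φ (optionCongr σ * optionCongr τ) +
      Fintype.card α * φ (optionCongr σ * Equiv.swap none (some i) * optionCongr τ)) =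
    (Fintype.card α).factorial * ∑ π : Equiv.Perm (Option α), φ π := by
  have h1 : ∑ π : Equiv.Perm (Option α), φ π =
      ∑ τ : Equiv.Perm α, φ (optionCongr τ) +
        ∑ k : α, ∑ τ : Equiv.Perm α, φ (Equiv.swap none (some k) * optionCongr τ) := by
    rw [← Equiv.sum_comp Equiv.Perm.decomposeOption.symm, Fintype.sum_prod_type,
      Fintype.sum_option]
    simp [Equiv.Perm.decomposeOption, Equiv.Perm.mul_def]
  have hm : ∀ σ τ : Equiv.Perm α,
      (optionCongr σ * optionCongr τ : Equiv.Perm (Option α)) = optionCongr (σ * τ) :=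
    fun σ τ => by ext x; cases x <;> simp
  -- Conjugation by `σ` turns the fixed partner `i` of `none` into the uniformly distributed `σ i`.
  have h2 : ∀ σ τ : Equiv.Perm α, (optionCongr σ * Equiv.swap none (some i) * optionCongr τ :
      Equiv.Perm (Option α)) = Equiv.swap none (some (σ i)) * optionCongr (σ * τ) := by
    intro σ τ
    rw [← hm, ← mul_assoc]
    congr 1
    have := Equiv.mul_swap_eq_swap_mul (optionCongr σ : Equiv.Perm (Option α)) none (some i)
    simpa using this
  have h3 : ∀ ψ : Equiv.Perm α → ℂ, ∀ σ : Equiv.Perm α, ∑ τ, ψ (σ * τ) = ∑ τ, ψ τ :=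
    fun ψ σ => Equiv.sum_comp (Equiv.mulLeft σ) ψ
  simp only [Finset.sum_add_distrib, hm, h2]
  rw [h1, mul_add]
  congr 1
  · simp [h3 (fun τ => φ (optionCongr τ)), Fintype.card_perm]
  · rw [← Equiv.Perm.card_mul_sum_apply _ i, Finset.mul_sum]
    refine Finset.sum_congr rfl fun σ _ => ?_
    rw [← Finset.mul_sum, h3 (fun τ => φ (Equiv.swap none (some (σ i)) * optionCongr τ))]

/-- Symmetrization over all permutations of the variables preserves stability of multi-affine
functions. -/
theorem MultiAffine.upperStable_symmetrize {α : Type*} [Fintype α] [DecidableEq α]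
    {f : (α → ℂ) → ℂ} (hf : MultiAffine f) (hs : UpperStable f) :
    UpperStable fun z => ∑ σ : Equiv.Perm α, f (z ∘ σ) := by
  classical
  suffices H : ∀ (_ : Fintype α) (_ : DecidableEq α) (f : (α → ℂ) → ℂ), MultiAffine f →
      UpperStable f → UpperStable fun z => ∑ σ : Equiv.Perm α, f (z ∘ σ) from H _ _ f hf hs
  clear hf hs f
  refine Finite.induction_empty_option (P := fun α => ∀ (_ : Fintype α) (_ : DecidableEq α)
    (f : (α → ℂ) → ℂ), MultiAffine f →
      UpperStable f → UpperStable fun z => ∑ σ : Equiv.Perm α, f (z ∘ σ)) ?_ ?_ ?_ α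
  · intro α β e ih _ _ f hf hs z hz
    have hfα : Fintype α := Fintype.ofEquiv β e.symm
    have h := ih hfα (Classical.decEq α) (fun z => f (z ∘ e.symm)) ?_ ?_ (z ∘ e) fun i => hz (e i)
    · simp only at h ⊢
      rw [Fintype.sum_equiv e.permCongr _ (fun σ => f (z ∘ σ))] at h
      · exact h
      · intro σ
        rfl
    · intro y i w
      have h : ∀ w, Function.update y i w ∘ e.symm = Function.update (y ∘ e.symm) (e i) w :=
        fun w => Function.update_comp_equiv y e.symm i w
      simp only [h]
      exact hf _ _ _
    · exact fun y hy => hs _ fun i => hy (e.symm i)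
  · intro _ _ f _ hs z hz
    simpa [Subsingleton.elim _ z] using hs z hz
  · intro α _ ih F D f hf hs z hz
    obtain rfl : F = instFintypeOption := Subsingleton.elim _ _
    obtain rfl : D = Option.instDecidableEq := Subsingleton.elim _ _
    rcases isEmpty_or_nonempty α with hα | ⟨⟨i⟩⟩
    · have : Subsingleton (Option α) := inferInstance
      have h1 : ∀ σ : Equiv.Perm (Option α), z ∘ σ = z := fun σ => by
        rw [Subsingleton.elim σ 1]; rfl
      simpa [h1, Fintype.card_perm, Nat.factorial_ne_zero] using hs z hz
    have key : ∀ g : (Option α → ℂ) → ℂ, MultiAffine g → UpperStable g →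
        UpperStable fun z => ∑ σ : Equiv.Perm α, g (z ∘ Equiv.optionCongr σ) := by
      intro g hg hgs y hy
      have := ih inferInstance inferInstance (fun x => g (fun o => o.elim (y none) x)) ?_ ?_
        (fun a => y (some a)) fun a => hy _
      · have e : ∀ σ : Equiv.Perm α, y ∘ Equiv.optionCongr σ =
            fun o => o.elim (y none) ((fun a => y (some a)) ∘ σ) := fun σ => by
          funext o
          cases o <;> rfl
        simp only [e]
        exact this
      · intro x j w
        have h : ∀ w, (fun o : Option α => o.elim (y none) (Function.update x j w)) =
            Function.update (fun o : Option α => o.elim (y none) x) (some j) w := by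
          intro w
          ext o
          cases o with
          | none => simp
          | some k => by_cases hk : k = j <;> simp [hk]
        simp only [h]
        exact hg _ _ _
      · intro x hx
        refine hgs _ fun o => ?_
        cases o with
        | none => exact hy none
        | some k => exact hx k
    have hmul : ∀ g : (Option α → ℂ) → ℂ, MultiAffine g →
        MultiAffine fun z => ∑ σ : Equiv.Perm α, g (z ∘ Equiv.optionCongr σ) :=
      fun g hg => MultiAffine.sum _ fun σ _ => hg.comp_perm (Equiv.optionCongr σ)
    -- Symmetrize over `α`, exchange `none` and `some i` with weights `1 : card α`, symmetrize
    -- again: this is a multiple of the full symmetrization.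
    have h1 := key f hf hs
    have h2 := (hmul f hf).upperStable_swap h1 (Option.some_ne_none i).symm zero_le_one
      (Nat.cast_nonneg (Fintype.card α)) (by positivity)
    have h3 := key _ (((hmul f hf).const_mul _).add
      (((hmul f hf).comp_perm _).const_mul _)) h2 z hz
    intro h0
    refine h3 ?_
    have := Equiv.Perm.sum_option_eq (fun π => f (z ∘ π)) i
    simp only at h0
    rw [h0, mul_zero] at this
    rw [← this]
    refine Finset.sum_congr rfl fun σ _ => ?_
    rw [Finset.sum_add_distrib, ← Finset.mul_sum]
    simp only [Complex.ofReal_one, one_mul, Complex.ofReal_natCast]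
    rfl

/-! ### Multi-affine parts of polynomials -/

namespace MvPolynomial

variable {ι : Type*}

open Classical in
/-- Evaluation of the multi-affine part: the linear map that evaluates square-free monomials at
`z` and annihilates all other monomials. -/
noncomputable def squarefreeEval (z : ι → ℂ) : MvPolynomial ι ℂ →ₗ[ℂ] ℂ :=
  (basisMonomials ι ℂ).constr ℂ fun m => if ∀ i, m i ≤ 1 then ∏ i ∈ m.support, z i else 0

open Classical in
theorem squarefreeEval_monomial (z : ι → ℂ) (m : ι →₀ ℕ) :
    squarefreeEval z (monomial m 1) = if ∀ i, m i ≤ 1 then ∏ i ∈ m.support, z i else 0 := by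
  have := (basisMonomials ι ℂ).constr_basis ℂ
    (fun m => if ∀ i, m i ≤ 1 then ∏ i ∈ m.support, z i else 0) m
  rwa [coe_basisMonomials] at this

theorem linearMap_induction {f g : MvPolynomial ι ℂ →ₗ[ℂ] ℂ}
    (h : ∀ m, f (monomial m 1) = g (monomial m 1)) (p : MvPolynomial ι ℂ) : f p = g p :=
  LinearMap.congr_fun ((basisMonomials ι ℂ).ext fun m => by simpa using h m) p

theorem squarefreeEval_one (z : ι → ℂ) : squarefreeEval z 1 = 1 := by
  rw [show (1 : MvPolynomial ι ℂ) = monomial 0 1 from rfl, squarefreeEval_monomial]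
  simp

/-- A polynomial whose multi-affine part has no zeros on the product of upper half-planes. -/
def SquarefreeStable (p : MvPolynomial ι ℂ) : Prop := UpperStable fun z => squarefreeEval z p

theorem SquarefreeStable.one : SquarefreeStable (1 : MvPolynomial ι ℂ) := fun z _ => by
  simp [squarefreeEval_one]

variable [DecidableEq ι]

/-- Setting the variable `u` to zero discards the monomials that already contain `X u`, which are
those that acquire a square. -/
theorem squarefreeEval_X_mul (z : ι → ℂ) (u : ι) (p : MvPolynomial ι ℂ) :
    squarefreeEval z (X u * p) = z u * squarefreeEval (Function.update z u 0) p := by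
  refine linearMap_induction (f := squarefreeEval z ∘ₗ LinearMap.mulLeft ℂ (X u))
    (g := z u • squarefreeEval (Function.update z u 0)) (fun m => ?_) p
  simp only [LinearMap.comp_apply, LinearMap.mulLeft_apply, LinearMap.smul_apply, smul_eq_mul]
  rw [X, monomial_mul, one_mul, squarefreeEval_monomial, squarefreeEval_monomial]
  by_cases hu : m u = 0
  · have h1 : (∀ i, (Finsupp.single u 1 + m : ι →₀ ℕ) i ≤ 1) ↔ ∀ i, m i ≤ 1 := by
      refine forall_congr' fun i => ?_
      by_cases hi : i = u
      · subst hi; simp [hu]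
      · simp [Ne.symm hi]
    have h2 : (Finsupp.single u 1 + m : ι →₀ ℕ).support = insert u m.support := by
      ext i
      by_cases hi : i = u
      · subst hi; simp
      · simp [hi]
    have h3 : u ∉ m.support := by simpa using hu
    by_cases hm : ∀ i, m i ≤ 1
    · rw [if_pos (h1.2 hm), if_pos hm, h2, Finset.prod_insert h3]
      congr 1
      refine Finset.prod_congr rfl fun i hi => ?_
      rw [Function.update_of_ne]
      rintro rfl
      exact h3 hi
    · rw [if_neg (h1.not.2 hm), if_neg hm, mul_zero]
  · rw [if_neg, Finset.prod_eq_zero (i := u), ite_self, mul_zero]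
    · simpa using hu
    · simp
    · intro h
      have := h u
      simp at this
      exact hu this

theorem squarefreeEval_X_sq_mul (z : ι → ℂ) (u : ι) (p : MvPolynomial ι ℂ) :
    squarefreeEval z (X u ^ 2 * p) = 0 := by
  rw [sq, mul_assoc, squarefreeEval_X_mul, squarefreeEval_X_mul]
  simp

theorem multiAffine_squarefreeEval (p : MvPolynomial ι ℂ) :
    MultiAffine fun z => squarefreeEval z p := by
  intro z u w
  refine linearMap_induction (f := squarefreeEval (Function.update z u w))
    (g := squarefreeEval (Function.update z u 0) + w •
      (squarefreeEval (Function.update z u 1) - squarefreeEval (Function.update z u 0)))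
    (fun m => ?_) p
  simp only [LinearMap.add_apply, LinearMap.smul_apply, LinearMap.sub_apply, smul_eq_mul,
    squarefreeEval_monomial]
  split_ifs
  · by_cases hu : u ∈ m.support
    · simp only [← Finset.mul_prod_erase _ _ hu, Function.update_self]
      have h : ∀ w, ∏ i ∈ m.support.erase u, Function.update z u w i =
          ∏ i ∈ m.support.erase u, z i := fun w => Finset.prod_congr rfl fun i hi =>
        Function.update_of_ne (Finset.ne_of_mem_erase hi) _ _
      simp only [h]
      ring
    · have h : ∀ w, ∏ i ∈ m.support, Function.update z u w i = ∏ i ∈ m.support, z i := fun w =>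
        Finset.prod_congr rfl fun i hi => Function.update_of_ne (by rintro rfl; exact hu hi) _ _
      simp only [h]
      ring
  · simp

theorem squarefreeEval_rename (z : ι → ℂ) (σ : Equiv.Perm ι) (p : MvPolynomial ι ℂ) :
    squarefreeEval z (rename σ p) = squarefreeEval (z ∘ σ) p := by
  refine linearMap_induction (f := squarefreeEval z ∘ₗ (rename σ).toLinearMap)
    (g := squarefreeEval (z ∘ σ)) (fun m => ?_) p
  simp only [LinearMap.comp_apply, AlgHom.toLinearMap_apply, rename_monomial,
    squarefreeEval_monomial]
  have h1 : (∀ i, (m.mapDomain σ) i ≤ 1) ↔ ∀ i, m i ≤ 1 := by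
    rw [← σ.forall_congr_right (q := fun i => m.mapDomain σ i ≤ 1)]
    simp only [Finsupp.mapDomain_apply σ.injective]
  by_cases hm : ∀ i, m i ≤ 1
  · rw [if_pos (h1.2 hm), if_pos hm, Finsupp.mapDomain_support_of_injective σ.injective, Finset.prod_image σ.injective.injOn]
    rfl
  · rw [if_neg (h1.not.2 hm), if_neg hm]

theorem SquarefreeStable.mul_one_sub {p : MvPolynomial ι ℂ} (hp : SquarefreeStable p) {u v : ι}
    (huv : u ≠ v) : SquarefreeStable (p * (1 - X u * X v)) := by
  have := (multiAffine_squarefreeEval p).upperStable_sub hp huv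
  intro z hz
  convert this z hz using 1
  simp only
  rw [show p * (1 - X u * X v) = p - X u * (X v * p) by ring, map_sub, squarefreeEval_X_mul,
    squarefreeEval_X_mul, Function.update_of_ne huv.symm, mul_assoc]

theorem SquarefreeStable.mul_prod {τ : Type*} (s : Finset τ) {a b : τ → ι}
    (hab : ∀ j ∈ s, a j ≠ b j) {p : MvPolynomial ι ℂ} (hp : SquarefreeStable p) :
    SquarefreeStable (p * ∏ j ∈ s, (1 - X (a j) * X (b j))) := by
  classical
  induction s using Finset.induction_on with
  | empty => simpa
  | insert j s hj ih =>
    rw [Finset.prod_insert hj, mul_comm (1 - _), ← mul_assoc]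
    exact (ih fun k hk => hab k (Finset.mem_insert_of_mem hk)).mul_one_sub
      (hab j (Finset.mem_insert_self _ _))

/-- The permutation of the variables `(v, i)` with index `v`. -/
def fiberPerm {α : Type*} [DecidableEq α] {δ : Type*} (v : α) (σ : Equiv.Perm δ) :
    Equiv.Perm (α × δ) :=
  Equiv.prodShear (Equiv.refl α) fun w => if w = v then σ else 1

theorem fiberPerm_apply {α : Type*} [DecidableEq α] {δ : Type*} (v : α) (σ : Equiv.Perm δ)
    (x : α × δ) : fiberPerm v σ x = (x.1, (if x.1 = v then σ else 1) x.2) := rfl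

/-- With the variables outside the fiber of `v` frozen, this is `MultiAffine.upperStable_symmetrize`
on the fiber. -/
theorem SquarefreeStable.symmetrize {α : Type*} [DecidableEq α] {δ : Type*} [Fintype δ]
    [DecidableEq δ] {p : MvPolynomial (α × δ) ℂ} (hp : SquarefreeStable p) (v : α) :
    SquarefreeStable (∑ σ : Equiv.Perm δ, rename (fiberPerm v σ) p) := by
  intro z hz
  let g : (δ → ℂ) → α × δ → ℂ := fun y x => if x.1 = v then y x.2 else z x
  have h := MultiAffine.upperStable_symmetrize (f := fun y => squarefreeEval (g y) p) ?_ ?_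
    (fun i => z (v, i)) fun i => hz _
  · convert h using 1
    simp only
    rw [map_sum]
    refine Finset.sum_congr rfl fun σ _ => ?_
    rw [squarefreeEval_rename]
    congr 2
    funext ⟨w, i⟩
    by_cases hw : w = v
    · subst hw; simp [g, fiberPerm_apply]
    · simp [g, fiberPerm_apply, hw]
  · intro y i w
    have : ∀ w, g (Function.update y i w) = Function.update (g y) (v, i) w := by
      intro w
      funext ⟨u, j⟩
      by_cases hu : u = v
      · subst hu
        by_cases hj : j = i
        · subst hj; simp [g]
        · simp [g, hj]
      · simp [g, hu]
    simp only [this]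
    exact multiAffine_squarefreeEval p _ _ _
  · refine fun y hy => hp _ fun x => ?_
    simp only [g]
    split_ifs
    · exact hy _
    · exact hz _

end MvPolynomial

/-! ### Loops: permutations versus Hamiltonian paths, modulo squares -/

namespace SquareZero

open Finset

variable {δ R : Type*} [DecidableEq δ] [CommRing R] {x : δ → R}

theorem prod_mul_eq_zero (hx : ∀ i, x i ^ 2 = 0) (σ : Equiv.Perm δ) {A : Finset δ} {k : δ}
    (hk : k ∈ A) : x (σ k) * ∏ a ∈ A, x (σ a) = 0 := by
  rw [← mul_prod_erase _ _ hk, ← mul_assoc, ← sq, hx, zero_mul]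

variable [Fintype δ] [Algebra ℂ R]

/-- The symmetrization of a square-free monomial in elements of square zero is a multiple of a
power of their sum. -/
theorem sum_perm_prod (hx : ∀ i, x i ^ 2 = 0) (A : Finset δ) :
    ∑ σ : Equiv.Perm δ, ∏ a ∈ A, x (σ a) =
      ((Fintype.card δ - #A).factorial : ℂ) • (∑ i, x i) ^ #A := by
  induction A using Finset.induction_on with
  | empty => simp [Fintype.card_perm, Nat.cast_smul_eq_nsmul]
  | insert j A hj ih =>
    have hlt : #A < Fintype.card δ := by
      have := card_le_univ (insert j A)
      rw [card_insert_of_notMem hj] at this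
      omega
    obtain ⟨n, hn⟩ : ∃ n, Fintype.card δ - #A = n + 1 := ⟨Fintype.card δ - #A - 1, by omega⟩
    have h1 : ∀ k ∈ Aᶜ, ∑ σ : Equiv.Perm δ, x (σ k) * ∏ a ∈ A, x (σ a) =
        ∑ σ : Equiv.Perm δ, ∏ a ∈ insert j A, x (σ a) := by
      intro k hk
      rw [mem_compl] at hk
      refine Fintype.sum_equiv (Equiv.mulRight (Equiv.swap k j)) _ _ fun σ => ?_
      rw [prod_insert hj]
      congr 1
      · simp
      · refine prod_congr rfl fun a ha => ?_
        rw [Equiv.coe_mulRight, Equiv.Perm.mul_apply, Equiv.swap_apply_of_ne_of_ne]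
        · rintro rfl; exact hk ha
        · rintro rfl; exact hj ha
    -- After multiplication by the sum only the `x (σ k)` with `k ∉ A` survive, and each contributes
    -- the same symmetrized monomial.
    have h2 : (∑ i, x i) * ∑ σ : Equiv.Perm δ, ∏ a ∈ A, x (σ a) =
        (n + 1) • ∑ σ : Equiv.Perm δ, ∏ a ∈ insert j A, x (σ a) := by
      rw [← hn, ← card_compl, ← sum_const, ← sum_congr rfl h1, sum_comm, mul_sum]
      refine sum_congr rfl fun σ _ => ?_
      rw [← Equiv.sum_comp σ, sum_mul]
      refine (sum_subset (subset_univ _) fun k _ hk => ?_).symm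
      exact prod_mul_eq_zero hx σ (by simpa using hk)
    rw [ih, hn, mul_smul_comm, ← pow_succ', ← Nat.cast_smul_eq_nsmul ℂ, Nat.factorial_succ,
      Nat.cast_mul, mul_smul] at h2
    rw [card_insert_of_notMem hj, show Fintype.card δ - (#A + 1) = n by omega]
    have hn0 : ((n + 1 : ℕ) : ℂ) ≠ 0 := by exact_mod_cast n.succ_ne_zero
    have := congrArg (((n + 1 : ℕ) : ℂ)⁻¹ • ·) h2
    simpa only [smul_smul, inv_mul_cancel₀ hn0, one_smul, inv_mul_cancel_left₀ hn0] using this.symm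

theorem sum_pow_eq_zero (hx : ∀ i, x i ^ 2 = 0) {m : ℕ} (hm : Fintype.card δ < m) :
    (∑ i, x i) ^ m = 0 := by
  obtain ⟨k, rfl⟩ := Nat.exists_eq_add_of_lt hm
  have h := sum_perm_prod hx (univ : Finset δ)
  rw [card_univ, Nat.sub_self, Nat.factorial_zero, Nat.cast_one, one_smul] at h
  rw [add_assoc, add_comm k 1, pow_add, pow_add, ← h, pow_one, ← mul_assoc, sum_mul]
  suffices ∀ σ : Equiv.Perm δ, (∏ a, x (σ a)) * ∑ i, x i = 0 by simp [this]
  intro σ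
  rw [mul_comm, ← Equiv.sum_comp σ, sum_mul]
  exact sum_eq_zero fun k _ => prod_mul_eq_zero hx σ (mem_univ k)

/-- An extra average over relabelings `ρ` makes the heads and tails of the chosen edges independent,
so each side is symmetrized separately by `sum_perm_prod`. -/
theorem factorial_mul_sum_perm_prod_one_sub (hx : ∀ i, x i ^ 2 = 0) :
    ((Fintype.card δ).factorial : ℂ) • ∑ σ : Equiv.Perm δ, ∏ i, (1 - x i * x (σ i)) =
      ∑ k ∈ range (Fintype.card δ + 1),
        ((-1) ^ k * (Fintype.card δ).choose k * ((Fintype.card δ - k).factorial : ℂ) ^ 2) •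
          (∑ i, x i) ^ (2 * k) := by
  have h1 : ∀ ρ : Equiv.Perm δ, ∑ σ : Equiv.Perm δ, ∏ i, (1 - x i * x (σ i)) =
      ∑ τ : Equiv.Perm δ, ∏ i, (1 - x (ρ i) * x (τ i)) := by
    intro ρ
    rw [← Equiv.sum_comp (Equiv.mulRight ρ⁻¹)]
    refine Finset.sum_congr rfl fun τ _ => ?_
    rw [← Equiv.prod_comp ρ]
    simp
  have h2 : ∀ ρ τ : Equiv.Perm δ, ∏ i, (1 - x (ρ i) * x (τ i)) =
      ∑ A : Finset δ, (-1) ^ #A * ((∏ a ∈ A, x (ρ a)) * ∏ a ∈ A, x (τ a)) := by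
    intro ρ τ
    simp only [sub_eq_add_neg, prod_one_add, powerset_univ, prod_neg, prod_mul_distrib]
  calc ((Fintype.card δ).factorial : ℂ) • ∑ σ : Equiv.Perm δ, ∏ i, (1 - x i * x (σ i))
      = ∑ ρ : Equiv.Perm δ, ∑ τ : Equiv.Perm δ, ∏ i, (1 - x (ρ i) * x (τ i)) := by
        rw [sum_congr rfl fun ρ _ => (h1 ρ).symm, sum_const, card_univ, Fintype.card_perm,
          Nat.cast_smul_eq_nsmul]
    _ = ∑ A : Finset δ, (-1) ^ #A * ((∑ ρ : Equiv.Perm δ, ∏ a ∈ A, x (ρ a)) *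
          ∑ τ : Equiv.Perm δ, ∏ a ∈ A, x (τ a)) := by
        simp only [h2]
        rw [sum_congr rfl fun ρ _ => sum_comm, sum_comm]
        refine sum_congr rfl fun A _ => ?_
        rw [sum_mul_sum, mul_sum]
        simp only [mul_sum]
    _ = ∑ A ∈ (univ : Finset δ).powerset, (fun k => ((-1 : ℂ) ^ k *
          ((Fintype.card δ - k).factorial : ℂ) ^ 2) • (∑ i, x i) ^ (2 * k)) #A := by
        rw [powerset_univ]
        refine sum_congr rfl fun A _ => ?_
        rw [sum_perm_prod hx, smul_mul_smul_comm, ← pow_add, ← two_mul, mul_smul_comm, ← sq,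
          mul_comm ((-1 : R) ^ #A)]
        simp only [Algebra.smul_def, map_mul, map_pow, map_neg, map_one]
        ring
    _ = _ := by
        rw [sum_powerset_apply_card fun k => ((-1 : ℂ) ^ k *
          ((Fintype.card δ - k).factorial : ℂ) ^ 2) • (∑ i, x i) ^ (2 * k), card_univ]
        refine sum_congr rfl fun k _ => ?_
        rw [← Nat.cast_smul_eq_nsmul ℂ, smul_smul]
        congr 1
        ring

/-- This is the matching recursion of a path on `m` vertices: delete the last edge, or use it and
drop its two ends. The set `B` records the ends already used, all at indices at least `m`. -/
theorem sum_perm_path (hx : ∀ i, x i ^ 2 = 0) (a : ℕ → δ)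
    (ha : Set.InjOn a (range (Fintype.card δ))) (m : ℕ) (B : Finset ℕ)
    (hB : B ⊆ Ico m (Fintype.card δ)) (hm : m ≤ Fintype.card δ) :
    ∑ σ : Equiv.Perm δ, (∏ j ∈ range (m - 1), (1 - x (σ (a j)) * x (σ (a (j + 1))))) *
        ∏ j ∈ B, x (σ (a j)) =
      ∑ k ∈ range (Fintype.card δ + 1),
        ((-1) ^ k * (m - k).choose k * ((Fintype.card δ - (2 * k + #B)).factorial : ℂ)) •
          (∑ i, x i) ^ (2 * k + #B) := by
  have base : ∀ B ⊆ range (Fintype.card δ), ∑ σ : Equiv.Perm δ, ∏ j ∈ B, x (σ (a j)) =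
      ((Fintype.card δ - #B).factorial : ℂ) • (∑ i, x i) ^ #B := by
    intro B hB
    have hB' : Set.InjOn a B := ha.mono (by exact_mod_cast hB)
    rw [← card_image_of_injOn hB', ← sum_perm_prod hx]
    exact sum_congr rfl fun σ _ => (prod_image (f := fun i => x (σ i)) hB').symm
  induction m using Nat.twoStepInduction generalizing B with
  | zero =>
    rw [sum_range_succ', sum_eq_zero (s := range (Fintype.card δ))]
    · simpa using base B (by rwa [range_eq_Ico])
    · intro k _
      simp
  | one =>
    rw [sum_range_succ', sum_eq_zero (s := range (Fintype.card δ))]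
    · simpa using base B (hB.trans fun j hj => by simp at hj ⊢; omega)
    · intro k _
      simp
  | more m ih0 ih1 =>
    have hm0 : m ∉ B := fun h => by have := mem_Ico.1 (hB h); omega
    have hm1 : m + 1 ∉ B := fun h => by have := mem_Ico.1 (hB h); omega
    have hm2 : m ∉ insert (m + 1) B := by simp [hm0]
    have h1 := ih1 B (hB.trans fun j hj => by simp at hj ⊢; omega) (by omega)
    have h0 := ih0 (insert m (insert (m + 1) B)) (by
      intro j hj
      simp only [mem_insert] at hj
      rcases hj with rfl | rfl | hj
      · simp; omega
      · simp; omega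
      · have := mem_Ico.1 (hB hj)
        simp; omega) (by omega)
    have hcard : #(insert m (insert (m + 1) B)) = #B + 2 := by
      rw [card_insert_of_notMem hm2, card_insert_of_notMem hm1]
    -- Using the last edge reduces the preceding edge's factor to 1, since their common vertex would
    -- be squared.
    have h2 : ∀ σ : Equiv.Perm δ,
        (∏ j ∈ range (m + 2 - 1), (1 - x (σ (a j)) * x (σ (a (j + 1))))) * ∏ j ∈ B, x (σ (a j)) =
        (∏ j ∈ range (m + 1 - 1), (1 - x (σ (a j)) * x (σ (a (j + 1))))) * ∏ j ∈ B, x (σ (a j)) -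
        (∏ j ∈ range (m - 1), (1 - x (σ (a j)) * x (σ (a (j + 1))))) *
          ∏ j ∈ insert m (insert (m + 1) B), x (σ (a j)) := by
      intro σ
      rw [prod_insert hm2, prod_insert hm1]
      cases m with
      | zero => simp; ring
      | succ m =>
        simp only [show m + 1 + 2 - 1 = m + 2 by omega, show m + 1 + 1 - 1 = m + 1 by omega,
          show m + 1 - 1 = m by omega, prod_range_succ _ (m + 1), prod_range_succ _ m]
        linear_combination (∏ j ∈ range m, (1 - x (σ (a j)) * x (σ (a (j + 1))))) *
          (∏ j ∈ B, x (σ (a j))) * x (σ (a m)) * x (σ (a (m + 2))) * hx (σ (a (m + 1)))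
    -- The top term of `h0` vanishes, so that its term `k` can be paired with term `k + 1` of `h1`;
    -- Pascal's rule then combines the coefficients.
    have hz : ((m - Fintype.card δ).choose (Fintype.card δ) : ℂ) = 0 := by
      rw [Nat.choose_eq_zero_of_lt (by omega), Nat.cast_zero]
    rw [sum_range_succ, hz, mul_zero, zero_mul, zero_smul, add_zero, hcard] at h0
    rw [sum_range_succ'] at h1
    rw [sum_congr rfl fun σ _ => h2 σ, sum_sub_distrib, h0, h1, sum_range_succ',
      add_sub_right_comm, ← sum_sub_distrib]
    congr 1
    · refine sum_congr rfl fun k _ => ?_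
      rw [show 2 * (k + 1) + #B = 2 * k + (#B + 2) by ring, ← sub_smul]
      congr 1
      by_cases hk : k ≤ m
      · rw [show m + 1 - (k + 1) = m - k by omega, show m + 2 - (k + 1) = m - k + 1 by omega,
          Nat.choose_succ_succ]
        push_cast
        ring
      · rw [show m + 1 - (k + 1) = 0 by omega, show m + 2 - (k + 1) = 0 by omega,
          show m - k = 0 by omega, Nat.choose_eq_zero_of_lt (show 0 < k by omega)]
        simp

/-- Modulo squares, the matchings of the functional graph of a uniform permutation and of a
uniform Hamiltonian path have the same average. -/
theorem sum_perm_prod_eq_sum_path (hx : ∀ i, x i ^ 2 = 0) (a : ℕ → δ)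
    (ha : Set.InjOn a (range (Fintype.card δ))) :
    ∑ σ : Equiv.Perm δ, ∏ i, (1 - x i * x (σ i)) =
      ∑ σ : Equiv.Perm δ, ∏ j ∈ range (Fintype.card δ - 1),
        (1 - x (σ (a j)) * x (σ (a (j + 1)))) := by
  have h1 := factorial_mul_sum_perm_prod_one_sub hx
  have h2 := sum_perm_path hx a ha (Fintype.card δ) ∅ (empty_subset _) le_rfl
  simp only [prod_empty, mul_one, card_empty, add_zero] at h2
  have h0 : ((Fintype.card δ).factorial : ℂ) ≠ 0 := by exact_mod_cast Nat.factorial_ne_zero _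
  suffices ((Fintype.card δ).factorial : ℂ) • ∑ σ : Equiv.Perm δ, ∏ i, (1 - x i * x (σ i)) =
      ((Fintype.card δ).factorial : ℂ) • ∑ σ : Equiv.Perm δ, ∏ j ∈ range (Fintype.card δ - 1),
        (1 - x (σ (a j)) * x (σ (a (j + 1)))) by
    have := congrArg (((Fintype.card δ).factorial : ℂ)⁻¹ • ·) this
    simpa only [smul_smul, inv_mul_cancel₀ h0, one_smul] using this
  rw [h1, h2, smul_sum]
  refine sum_congr rfl fun k hk => ?_
  -- Both coefficients equal `(-1)^k d! (d-k)!/k!`, with `d` the size of `δ`; for `2k > d` the power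
  -- of the sum is zero.
  by_cases hkd : 2 * k ≤ Fintype.card δ
  · rw [smul_smul]
    congr 1
    have e1 := Nat.choose_mul_factorial_mul_factorial (show k ≤ Fintype.card δ by omega)
    have e2 := Nat.choose_mul_factorial_mul_factorial (show k ≤ Fintype.card δ - k by omega)
    rw [show Fintype.card δ - k - k = Fintype.card δ - 2 * k by omega] at e2
    have hk0 : (k.factorial : ℂ) ≠ 0 := by exact_mod_cast Nat.factorial_ne_zero _
    have e1' : ((Fintype.card δ).choose k : ℂ) * k.factorial * (Fintype.card δ - k).factorial =
      (Fintype.card δ).factorial := by exact_mod_cast e1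
    have e2' : ((Fintype.card δ - k).choose k : ℂ) * k.factorial *
      (Fintype.card δ - 2 * k).factorial = (Fintype.card δ - k).factorial := by exact_mod_cast e2
    refine mul_left_cancel₀ hk0 ?_
    linear_combination (-1) ^ k * ((Fintype.card δ - k).factorial : ℂ) * e1' -
      (-1) ^ k * ((Fintype.card δ).factorial : ℂ) * e2'
  · rw [sum_pow_eq_zero hx (by omega), smul_zero, smul_zero, smul_zero]

end SquareZero

/-! ### Stability of products of edge sums -/

namespace MvPolynomial

theorem squarefreeEval_mul_congr {ι : Type*} [DecidableEq ι] (z : ι → ℂ) (p : MvPolynomial ι ℂ)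
    {q q' : MvPolynomial ι ℂ}
    (h : q - q' ∈ Ideal.span (Set.range fun i : ι => (X i : MvPolynomial ι ℂ) ^ 2)) :
    squarefreeEval z (p * q) = squarefreeEval z (p * q') := by
  rw [← sub_eq_zero, ← map_sub, ← mul_sub]
  generalize q - q' = r at h
  induction h using Submodule.span_induction generalizing p with
  | mem r hr =>
    obtain ⟨i, rfl⟩ := hr
    rw [mul_comm, squarefreeEval_X_sq_mul]
  | zero => simp
  | add r s _ _ hr hs => rw [mul_add, map_add, hr, hs, add_zero]
  | smul c r _ hr => rw [smul_eq_mul, ← mul_assoc, hr]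

variable {α : Type*} [DecidableEq α] {δ : Type*} [Fintype δ] [DecidableEq δ]

/-- The signed matching generating polynomial, modulo squares, of the edges that join `(u, i)` to
`(v, σ i)`, summed over all permutations `σ`. -/
noncomputable def edgeSum (δ : Type*) [Fintype δ] [DecidableEq δ] (u v : α) :
    MvPolynomial (α × δ) ℂ :=
  ∑ σ : Equiv.Perm δ, ∏ i, (1 - X (u, i) * X (v, σ i))

/-- Relabeling the two end fibers is absorbed by the substitution `σ ↦ r v * σ * (r u)⁻¹`, also when
`u = v`. -/
theorem rename_fiberPerm_edgeSum (w : α) (ρ : Equiv.Perm δ) (u v : α) :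
    rename (fiberPerm w ρ) (edgeSum δ u v) = edgeSum δ u v := by
  set r : α → Equiv.Perm δ := fun x => if x = w then ρ else 1
  have hr : ∀ x i, fiberPerm w ρ (x, i) = (x, r x i) := fun x i => rfl
  rw [edgeSum, map_sum]
  refine Fintype.sum_equiv ((Equiv.mulLeft (r v)).trans (Equiv.mulRight (r u)⁻¹)) _ _ fun σ => ?_
  rw [map_prod]
  exact Fintype.prod_equiv (r u) _ _ fun i => by simp [hr]

theorem edgeSum_of_ne {u v : α} (huv : u ≠ v) : edgeSum δ u v =
    ∑ σ : Equiv.Perm δ, rename (fiberPerm v σ) (∏ i, (1 - X (u, i) * X (v, i))) := by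
  refine Finset.sum_congr rfl fun σ _ => ?_
  simp [map_prod, fiberPerm_apply, huv]

theorem squarefreeEval_mul_edgeSum_self (z : α × δ → ℂ) (p : MvPolynomial (α × δ) ℂ) (v : α)
    (a : ℕ → δ) (ha : Set.InjOn a (Finset.range (Fintype.card δ))) :
    squarefreeEval z (p * edgeSum δ v v) =
      squarefreeEval z (p * ∑ σ : Equiv.Perm δ, rename (fiberPerm v σ)
        (∏ j ∈ Finset.range (Fintype.card δ - 1), (1 - X (v, a j) * X (v, a (j + 1))))) := by
  refine squarefreeEval_mul_congr z p (Ideal.Quotient.eq.1 ?_)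
  set I := Ideal.span (Set.range fun i : α × δ => (X i : MvPolynomial (α × δ) ℂ) ^ 2)
  have := SquareZero.sum_perm_prod_eq_sum_path (x := fun i : δ => Ideal.Quotient.mk I (X (v, i)))
    (fun i => by
      rw [← map_pow]
      exact Ideal.Quotient.eq_zero_iff_mem.2 (Ideal.subset_span ⟨_, rfl⟩)) a ha
  simpa [edgeSum, map_sum, map_prod, fiberPerm_apply] using this

/-- Invariance under the permutations of every fiber `{v} × δ`. -/
def FiberInvariant (p : MvPolynomial (α × δ) ℂ) : Prop :=
  ∀ (v : α) (σ : Equiv.Perm δ), rename (fiberPerm v σ) p = p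

theorem FiberInvariant.mul_sum_rename {p : MvPolynomial (α × δ) ℂ} (hp : FiberInvariant p)
    (v : α) (q : MvPolynomial (α × δ) ℂ) :
    p * ∑ σ : Equiv.Perm δ, rename (fiberPerm v σ) q =
      ∑ σ : Equiv.Perm δ, rename (fiberPerm v σ) (p * q) := by
  simp only [Finset.mul_sum, map_mul, hp v _]

theorem SquarefreeStable.mul_edgeSum [Nonempty δ] {p : MvPolynomial (α × δ) ℂ} (hp : SquarefreeStable p)
    (hi : FiberInvariant p) (u v : α) : SquarefreeStable (p * edgeSum δ u v) := by
  by_cases huv : u = v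
  · subst huv
    obtain ⟨a, ha⟩ : ∃ a : ℕ → δ, Set.InjOn a (Finset.range (Fintype.card δ)) := by
      obtain ⟨i⟩ := ‹Nonempty δ›
      refine ⟨fun j => if h : j < Fintype.card δ then (Fintype.equivFin δ).symm ⟨j, h⟩ else i, ?_⟩
      intro j hj k hk hjk
      simp only [Finset.coe_range, Set.mem_Iio] at hj hk
      simpa [hj, hk] using hjk
    intro z hz
    simp only
    rw [squarefreeEval_mul_edgeSum_self z p u a ha, hi.mul_sum_rename]
    refine (hp.mul_prod _ fun j hj h => ?_).symmetrize u z hz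
    have hj := Finset.mem_range.1 hj
    have := ha (by simp; omega) (by simp; omega) (Prod.ext_iff.1 h).2
    omega
  · rw [edgeSum_of_ne huv, hi.mul_sum_rename]
    exact (hp.mul_prod _ fun j _ h => huv (Prod.ext_iff.1 h).1).symmetrize v

theorem SquarefreeStable.prod_edgeSum [Nonempty δ] {ε : Type*} (s : Finset ε) (h t : ε → α) :
    SquarefreeStable (∏ e ∈ s, edgeSum δ (h e) (t e)) := by
  classical
  induction s using Finset.induction_on with
  | empty => simpa using SquarefreeStable.one
  | insert e s he ih =>
    rw [Finset.prod_insert he, mul_comm]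
    refine ih.mul_edgeSum (fun v σ => ?_) _ _
    simp only [map_prod, rename_fiberPerm_edgeSum]

end MvPolynomial

/-! ### Square-free evaluation and matchings -/

namespace MvPolynomial

open Finset

variable {ι : Type*} [DecidableEq ι]

/-- The pairs `(a e, b e)`, `e ∈ M`, have no coordinate in common, within a pair or across pairs. -/
def PairwiseDisjointEnds {τ : Type*} (a b : τ → ι) (M : Finset τ) : Prop :=
  (∀ e ∈ M, a e ≠ b e) ∧
    ∀ e ∈ M, ∀ f ∈ M, e ≠ f → a e ≠ a f ∧ a e ≠ b f ∧ b e ≠ a f ∧ b e ≠ b f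

open Classical in
theorem squarefreeEval_prod {τ : Type*} (a b : τ → ι) (M : Finset τ) (z : ι → ℂ) :
    squarefreeEval z (∏ e ∈ M, X (a e) * X (b e)) =
      if PairwiseDisjointEnds a b M then ∏ e ∈ M, z (a e) * z (b e) else 0 := by
  induction M using Finset.induction_on generalizing z with
  | empty => simp [squarefreeEval_one, PairwiseDisjointEnds]
  | insert e M he ih =>
    rw [prod_insert he, mul_assoc, squarefreeEval_X_mul, squarefreeEval_X_mul, ih]
    -- Peeling off `e` sets the variables at its two ends to zero, so any later pair meeting `e`
    -- kills the product.
    set z' := Function.update (Function.update z (a e) 0) (b e) 0 with hz'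
    have hza : z' (a e) = 0 := by
      by_cases h : a e = b e
      · rw [hz', h, Function.update_self]
      · rw [hz', Function.update_of_ne h, Function.update_self]
    have hzb : z' (b e) = 0 := Function.update_self _ _ _
    by_cases hM : PairwiseDisjointEnds a b M
    swap
    · rw [if_neg hM, if_neg, mul_zero, mul_zero]
      exact fun h => hM ⟨fun f hf => h.1 f (mem_insert_of_mem hf), fun f hf g hg =>
        h.2 f (mem_insert_of_mem hf) g (mem_insert_of_mem hg)⟩
    rw [if_pos hM]
    by_cases hab : a e = b e
    · rw [hab, Function.update_self, zero_mul, mul_zero, if_neg]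
      exact fun h => h.1 e (mem_insert_self _ _) hab
    rw [Function.update_of_ne (Ne.symm hab)]
    by_cases hd : ∀ f ∈ M, a e ≠ a f ∧ a e ≠ b f ∧ b e ≠ a f ∧ b e ≠ b f
    · rw [if_pos, prod_insert he, mul_assoc]
      · congr 2
        refine prod_congr rfl fun f hf => ?_
        obtain ⟨h1, h2, h3, h4⟩ := hd f hf
        rw [hz', Function.update_of_ne h3.symm, Function.update_of_ne h4.symm,
          Function.update_of_ne h1.symm, Function.update_of_ne h2.symm]
      · refine ⟨fun f hf => ?_, fun f hf g hg hfg => ?_⟩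
        · rcases mem_insert.1 hf with rfl | hf
          · exact hab
          · exact hM.1 f hf
        · rcases mem_insert.1 hf with rfl | hf'
          · exact hd g ((mem_insert.1 hg).resolve_left hfg.symm)
          · rcases mem_insert.1 hg with rfl | hg'
            · obtain ⟨h1, h2, h3, h4⟩ := hd f hf'
              exact ⟨h1.symm, h3.symm, h2.symm, h4.symm⟩
            · exact hM.2 f hf' g hg' hfg
    · rw [if_neg]
      · push Not at hd
        obtain ⟨f, hf, h⟩ := hd
        rw [prod_eq_zero hf, mul_zero, mul_zero]
        by_cases h1 : a e = a f
        · rw [← h1, hza, zero_mul]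
        by_cases h2 : a e = b f
        · rw [← h2, hza, mul_zero]
        by_cases h3 : b e = a f
        · rw [← h3, hzb, zero_mul]
        rw [← h h1 h2 h3, hzb, mul_zero]
      · refine fun h => hd fun f hf => h.2 e (mem_insert_self _ _) f (mem_insert_of_mem hf) ?_
        rintro rfl
        exact he hf

open Classical in
theorem squarefreeEval_prod_one_sub {τ : Type*} [Fintype τ] (a b : τ → ι) (y : ℂ) :
    squarefreeEval (fun _ => y) (∏ e, (1 - X (a e) * X (b e))) =
      ∑ M : Finset τ, if PairwiseDisjointEnds a b M then (-1) ^ #M * y ^ (2 * #M) else 0 := by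
  simp only [sub_eq_add_neg, prod_one_add, powerset_univ, prod_neg, map_sum]
  refine sum_congr rfl fun M _ => ?_
  rw [show ((-1 : MvPolynomial ι ℂ) ^ #M) = C ((-1) ^ #M) by simp, ← smul_eq_C_mul, map_smul,
    squarefreeEval_prod]
  split_ifs
  · rw [prod_const, smul_eq_mul, pow_mul, sq]
  · rw [smul_zero]

theorem PairwiseDisjointEnds.two_mul_card_le {τ : Type*} {a b : τ → ι} {M : Finset τ}
    (h : PairwiseDisjointEnds a b M) {V : Finset ι} (ha : ∀ e ∈ M, a e ∈ V)
    (hb : ∀ e ∈ M, b e ∈ V) : 2 * #M ≤ #V := by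
  have h1 : #(M.image a) = #M := card_image_of_injOn fun e he f hf hef => by
    by_contra hne
    exact (h.2 e he f hf hne).1 hef
  have h2 : #(M.image b) = #M := card_image_of_injOn fun e he f hf hef => by
    by_contra hne
    exact (h.2 e he f hf hne).2.2.2 hef
  have h3 : Disjoint (M.image a) (M.image b) := by
    rw [disjoint_left]
    intro x hx hx'
    obtain ⟨e, he, rfl⟩ := mem_image.1 hx
    obtain ⟨f, hf, hfe⟩ := mem_image.1 hx'
    by_cases hef : e = f
    · subst hef; exact h.1 e he hfe.symm
    · exact (h.2 e he f hf hef).2.1 hfe.symm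
  rw [two_mul]
  nth_rw 1 [← h1]
  rw [← h2, ← card_union_of_disjoint h3]
  refine card_le_card (union_subset ?_ ?_)
  · exact image_subset_iff.2 ha
  · exact image_subset_iff.2 hb

end MvPolynomial

/-! ### Matching polynomials of coverings -/

namespace Graph

open Finset MvPolynomial

variable {α β : Type*} {G : Graph α β}

/-- The first end `(head e, i)` of the edge `(e, i)` of a covering. -/
def coverHead (o : G.EdgeOrientation) {d : ℕ} (e : G.edgeSet × Fin d) : α × Fin d :=
  (o.head e.1, e.2)

/-- The second end `(tail e, σ e i)` of the edge `(e, i)` of a covering. -/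
def coverTail (o : G.EdgeOrientation) {d : ℕ} (σ : G.PermLabeling d) (e : G.edgeSet × Fin d) :
    α × Fin d := (o.tail e.1, σ.pos e.1 e.2)

/-- The edges of a covering. -/
def coverEdge (G : Graph α β) (d : ℕ) : G.edgeSet × Fin d ↪ β × Fin d where
  toFun e := (e.1, e.2)
  inj' := by
    rintro ⟨e, i⟩ ⟨f, j⟩ h
    simp only [Prod.mk.injEq] at h
    exact Prod.ext (Subtype.ext h.1) h.2

theorem covering_isLink_coverEdge (o : G.EdgeOrientation) {d : ℕ} (σ : G.PermLabeling d)
    (e : G.edgeSet × Fin d) (x y : α × Fin d) :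
    (G.covering o σ).IsLink (coverEdge G d e) x y ↔ s(x, y) = s(coverHead o e, coverTail o σ e) :=
  ⟨fun ⟨_, h⟩ => h, fun h => ⟨e.1.2, h⟩⟩

theorem covering_inc_coverEdge (o : G.EdgeOrientation) {d : ℕ} (σ : G.PermLabeling d)
    (e : G.edgeSet × Fin d) (x : α × Fin d) :
    (G.covering o σ).Inc (coverEdge G d e) x ↔ x = coverHead o e ∨ x = coverTail o σ e := by
  simp only [Graph.Inc, covering_isLink_coverEdge, Sym2.eq_iff]
  constructor
  · rintro ⟨y, ⟨h, -⟩ | ⟨h, -⟩⟩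
    · exact Or.inl h
    · exact Or.inr h
  · rintro (rfl | rfl)
    · exact ⟨_, Or.inl ⟨rfl, rfl⟩⟩
    · exact ⟨_, Or.inr ⟨rfl, rfl⟩⟩

theorem mem_range_coverEdge (o : G.EdgeOrientation) {d : ℕ} (σ : G.PermLabeling d)
    {e : β × Fin d} : e ∈ (G.covering o σ).edgeSet ↔ e ∈ Set.range (coverEdge G d) := by
  constructor
  · intro h
    obtain ⟨x, y, hxy⟩ := Graph.exists_isLink_of_mem_edgeSet h
    obtain ⟨he, -⟩ := hxy
    exact ⟨(⟨e.1, he⟩, e.2), rfl⟩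
  · rintro ⟨e, rfl⟩
    exact ((covering_isLink_coverEdge o σ e _ _).2 rfl).edge_mem

theorem isMatching_map_coverEdge (o : G.EdgeOrientation) {d : ℕ} (σ : G.PermLabeling d)
    (M : Finset (G.edgeSet × Fin d)) : (G.covering o σ).IsMatching (M.map (coverEdge G d)) ↔
      PairwiseDisjointEnds (coverHead o) (coverTail o σ) M := by
  have hloop : ∀ e, (∀ x, ¬ (G.covering o σ).IsLoopAt (coverEdge G d e) x) ↔
      coverHead o e ≠ coverTail o σ e := by
    intro e
    simp only [← Graph.isLink_self_iff, covering_isLink_coverEdge, Sym2.eq_iff]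
    constructor
    · intro h h'
      exact h _ (Or.inl ⟨rfl, h'⟩)
    · rintro h x (⟨h1, h2⟩ | ⟨h1, h2⟩)
      · exact h (h1.symm.trans h2)
      · exact h (h2.symm.trans h1)
  have hinc : ∀ e f, (∀ x, ¬ ((G.covering o σ).Inc (coverEdge G d e) x ∧
      (G.covering o σ).Inc (coverEdge G d f) x)) ↔
      coverHead o e ≠ coverHead o f ∧ coverHead o e ≠ coverTail o σ f ∧
        coverTail o σ e ≠ coverHead o f ∧ coverTail o σ e ≠ coverTail o σ f := by
    intro e f
    simp only [covering_inc_coverEdge]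
    constructor
    · intro h
      have h1 := h (coverHead o e)
      have h2 := h (coverTail o σ e)
      tauto
    · rintro h x ⟨rfl | rfl, hx⟩ <;> tauto
  simp only [IsMatching, PairwiseDisjointEnds, mem_map, forall_exists_index, and_imp,
    forall_apply_eq_imp_iff₂, hloop, hinc, mem_range_coverEdge o σ, Set.mem_range_self, true_and,
    ne_eq, EmbeddingLike.apply_eq_iff_eq]

open Classical in
theorem numMatchings_covering [Fintype G.edgeSet] (o : G.EdgeOrientation) {d : ℕ}
    (σ : G.PermLabeling d) (i : ℕ) : (G.covering o σ).numMatchings i =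
      #{M : Finset (G.edgeSet × Fin d) |
        PairwiseDisjointEnds (coverHead o) (coverTail o σ) M ∧ #M = i} := by
  rw [numMatchings, ← Set.ncard_coe_finset]
  rw [← Set.ncard_image_of_injective _ (Finset.map_injective (coverEdge G d))]
  congr 1
  ext M
  simp only [Set.mem_ofPred_eq, coe_filter, mem_univ, true_and, Set.mem_image]
  constructor
  · rintro ⟨hM, hi⟩
    have hsub : (M : Set (β × Fin d)) ⊆ Set.range (coverEdge G d) := fun e he =>
      (mem_range_coverEdge o σ).1 (hM.1 e he).1
    obtain ⟨M', rfl⟩ : ∃ M' : Finset (G.edgeSet × Fin d), M'.map (coverEdge G d) = M := by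
      refine ⟨M.preimage _ (coverEdge G d).injective.injOn, ?_⟩
      rw [map_eq_image, image_preimage, filter_true_of_mem fun e he => hsub he]
    exact ⟨M', ⟨(isMatching_map_coverEdge o σ M').1 hM, by rwa [card_map] at hi⟩, rfl⟩
  · rintro ⟨M', ⟨hM, hi⟩, rfl⟩
    exact ⟨(isMatching_map_coverEdge o σ M').2 hM, by rwa [card_map]⟩

/-- Each edge uses two variables, so only even powers of `y` occur and the sign of `y = ±1/z` is
free. -/
theorem aeval_matchingPoly_covering [DecidableEq α] [Fintype G.edgeSet] (hV : G.vertexSet.Finite)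
    (o : G.EdgeOrientation) {d : ℕ} (σ : G.PermLabeling d) {z y : ℂ} (hz : z ≠ 0)
    (hy : y ^ 2 = (z⁻¹) ^ 2) :
    Polynomial.aeval z (((G.covering o σ).matchingPoly).map (Int.castRingHom ℝ)) =
      z ^ {x : α × Fin d | x.1 ∈ G.vertexSet}.ncard * squarefreeEval (fun _ => y)
        (∏ e : G.edgeSet × Fin d, (1 - X (coverHead o e) * X (coverTail o σ e))) := by
  classical
  have hfin : (G.covering o σ).vertexSet.Finite := by
    refine (hV.prod (Set.finite_univ (α := Fin d))).subset fun x hx => ⟨hx, trivial⟩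
  change _ = z ^ (G.covering o σ).vertexSet.ncard * _
  set N := (G.covering o σ).vertexSet.ncard with hN
  have hcard : ∀ M : Finset (G.edgeSet × Fin d),
      PairwiseDisjointEnds (coverHead o) (coverTail o σ) M → #M ∈ range (N / 2 + 1) := by
    intro M hM
    have := hM.two_mul_card_le (V := hfin.toFinset)
      (fun e _ => (hfin.mem_toFinset).2 (o.isLink e.1).left_mem)
      (fun e _ => (hfin.mem_toFinset).2 (o.isLink e.1).right_mem)
    rw [← Set.ncard_eq_toFinset_card _ hfin] at this
    rw [mem_range]
    omega
  rw [squarefreeEval_prod_one_sub, ← sum_filter,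
    ← sum_fiberwise_of_maps_to (g := card) (t := range (N / 2 + 1))
      fun M hM => hcard M (mem_filter.1 hM).2, mul_sum, matchingPoly, Polynomial.map_sum, map_sum]
  refine sum_congr rfl fun i hi => ?_
  rw [filter_filter, sum_congr rfl fun M hM => by rw [(mem_filter.1 hM).2.2], sum_const,
    ← numMatchings_covering, ← hN, pow_mul, hy, ← pow_mul]
  have hi' : 2 * i ≤ N := by
    rw [mem_range] at hi
    omega
  have : z ^ N = z ^ (N - 2 * i) * z ^ (2 * i) := by rw [← pow_add, Nat.sub_add_cancel hi']
  rw [this]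
  simp
  field_simp

/-- A labeling is determined by the permutations of the positively oriented edges. -/
def PermLabeling.equivPos (G : Graph α β) (d : ℕ) :
    G.PermLabeling d ≃ (G.edgeSet → Equiv.Perm (Fin d)) where
  toFun σ := σ.pos
  invFun s := ⟨fun e => if e.2 then s e.1 else (s e.1)⁻¹, by
    rintro ⟨e, b⟩
    cases b <;> simp [OrientedEdge.rev]⟩
  left_inv σ := by
    refine Subtype.ext (funext ?_)
    rintro ⟨e, b⟩
    cases b
    · exact (σ.2 (e, true)).symm
    · rfl
  right_inv s := rfl

/-- The positive edges carry independent permutations, so distributivity factors the sum over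
labelings. -/
theorem sum_labelings_eq_prod_edgeSum [DecidableEq α] [Fintype G.edgeSet] (o : G.EdgeOrientation)
    (d : ℕ) [Fintype (G.PermLabeling d)] :
    ∑ σ : G.PermLabeling d, ∏ e : G.edgeSet × Fin d,
      (1 - X (coverHead o e) * X (coverTail o σ e) : MvPolynomial (α × Fin d) ℂ) =
    ∏ e : G.edgeSet, edgeSum (Fin d) (o.head e) (o.tail e) := by
  classical
  simp only [edgeSum, prod_univ_sum, Fintype.piFinset_univ, Fintype.prod_prod_type]
  exact Fintype.sum_equiv (PermLabeling.equivPos G d) _ _ fun σ => rfl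

end Graph

theorem mainTheorem3 {α β : Type*} (G : Graph α β) (hV : G.vertexSet.Finite)
    (hE : G.edgeSet.Finite) (o : G.EdgeOrientation) (d : ℕ) (hd : 1 ≤ d) :
    (G.dMatchingPoly o d).IsRealRooted := by
  classical
  intro z h0
  by_contra him
  have : Fintype G.edgeSet := hE.fintype
  have : Fintype (G.PermLabeling d) := Fintype.ofEquiv _ (Graph.PermLabeling.equivPos G d).symm
  have : Nonempty (G.PermLabeling d) := ⟨(Graph.PermLabeling.equivPos G d).symm 1⟩
  have : Nonempty (Fin d) := ⟨⟨0, hd⟩⟩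
  have hz : z ≠ 0 := by rintro rfl; simp at him
  obtain ⟨y, hy, hy'⟩ : ∃ y : ℂ, y ^ 2 = (z⁻¹) ^ 2 ∧ 0 < y.im := by
    have : z⁻¹.im ≠ 0 := by
      rw [Complex.inv_im]
      exact div_ne_zero (neg_ne_zero.2 him) (Complex.normSq_pos.2 hz).ne'
    rcases this.lt_or_gt with h | h
    · exact ⟨-z⁻¹, neg_sq _, by simpa using h⟩
    · exact ⟨z⁻¹, rfl, h⟩
  have hst := MvPolynomial.SquarefreeStable.prod_edgeSum (δ := Fin d) Finset.univ o.head o.tail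
    (fun _ => y) fun _ => hy'
  simp only at hst
  rw [← Graph.sum_labelings_eq_prod_edgeSum o d, map_sum] at hst
  rw [Graph.dMatchingPoly, finsum_eq_sum_of_fintype, map_smul, map_sum,
    Finset.sum_congr rfl fun σ _ => Graph.aeval_matchingPoly_covering hV o σ hz hy,
    ← Finset.mul_sum] at h0
  have hc : (Nat.card (G.PermLabeling d) : ℝ)⁻¹ ≠ 0 :=
    inv_ne_zero (Nat.cast_ne_zero.2 Nat.card_pos.ne')
  exact smul_ne_zero hc (mul_ne_zero (pow_ne_zero _ hz) hst) h0
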